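/- Let $B\subseteq\mathbb{C}$ be an open disk with coordinate $t$, and let $(\mathbb{V}_{\mathbb{Z}},E,Q)$ be a polarized variation of Hodge structures of weight one over $B$: $\mathbb{V}_{\mathbb{Z}}$ is a local system of free abelian groups of rank $2g$; $Q$ is a flat, antisymmetric, unimodular $\mathbb{Z}$-bilinear form on $\mathbb{V}_{\mathbb{Z}}$; and $E=E^{1,0}\subseteq\mathcal{H}:=\mathbb{V}_{\mathbb{Z}}\otimes_{\mathbb{Z}}\mathcal{O}_B$ is a holomorphic subbundle of rank $g$ which is isotropic for $Q_{\mathbb{C}}$ and on which the Hodge metric $h(u,v)=iQ_{\mathbb{C}}(u,\overline{v})$ is positive definite. Let $\nabla^{GM}\colon\mathcal{H}\to\mathcal{H}\otimes\Omega^1_B$ be the Gauss–Manin connection (induced by the exterior derivative $d$ and vanishing on $\mathbb{V}_{\mathbb{Z}}$), let $\nabla^{GM}_t$ be its contraction with $\partial/\partial t$, and let $$\theta\colon E\hookrightarrow\mathcal{H}\xrightarrow{\ \nabla^{GM}\ }\mathcal{H}\otimes\Omega^1_B\longrightarrow(\mathcal{H}/E)\otimes\Omega^1_B$$ be the Higgs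 field. Put $\mathcal{K}:=\ker\theta\subseteq E$, let $\mathbb{U}:=\ker(\nabla^{GM}|_E)$ be the local system of flat sections of $E$, and let $\mathcal{U}:=\mathbb{U}\otimes_{\mathbb{C}}\mathcal{O}_B\subseteq E$ be the flat unitary subbundle. **Theorem 2.3.** Let $\alpha\in\Gamma(B,E)$ be a holomorphic section of $E$. Then $$\alpha\in\Gamma(B,\mathcal{U})\iff \alpha,\ \nabla^{GM}_t\alpha,\ \ldots,\ (\nabla^{GM}_t)^{g-1}\alpha\in\Gamma(B,\mathcal{K}),$$ or equivalently $$\alpha\in\Gamma(B,\mathcal{U})\iff \theta\big((\nabla^{GM}_t)^j\alpha\big)=0\quad\text{for all } j=0,\ldots,g-1.$$ (In the second form, $\theta$ of a holomorphic section of $\mathcal{H}$ means the class of its $\nabla^{GM}$-derivative in $(\mathcal{H}/E)\otimes\Omega^1_B$; the vanishing for the indices below $j$ already forces $(\nabla^{GM}_t)^j\alpha$ to be a section of $E$.) -/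

import Mathlib

open scoped TensorProduct Topology
open TopologicalSpace

universe u v

noncomputable section

/-- A local system of free abelian groups of rank `n` on a topological space `X`, given by its
stalks (fibres) together with local trivializations whose transition maps are locally constant.
There is one trivialization for each point `b`, defined over an open neighbourhood `dom b` of `b`;
the values `triv b x` for `x` outside `dom b` carry no information. -/
structure IntegralLocalSystem (X : Type v) [TopologicalSpace X] (n : ℕ) where
  fiber : X → Type u
  [addCommGroup : ∀ x, AddCommGroup (fiber x)]
  dom : X → Opens X
  mem_dom : ∀ b, b ∈ dom b
  triv : ∀ _b x : X, fiber x ≃ₗ[ℤ] (Fin n → ℤ)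
  transition_locally_constant : ∀ b b' y : X, y ∈ dom b → y ∈ dom b' →
    ∀ᶠ x in 𝓝 y, (triv b x).symm.trans (triv b' x) = (triv b y).symm.trans (triv b' y)

attribute [instance] IntegralLocalSystem.addCommGroup

namespace IntegralLocalSystem

variable {X : Type v} [TopologicalSpace X] {n : ℕ} (V : IntegralLocalSystem.{u} X n)

/-- The fibre at `x` of the vector bundle `ℋ = 𝕍_ℤ ⊗ 𝒪_B`, i.e. the complexification of the
fibre of the local system. -/
abbrev H (x : X) : Type u := ℂ ⊗[ℤ] V.fiber x

/-- Complex conjugation on `ℋ_x = ℂ ⊗ 𝕍_{ℤ,x}`, acting on the factor `ℂ`. -/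
def conj (x : X) : V.H x →ₗ[ℤ] V.H x :=
  LinearMap.rTensor (V.fiber x) (starRingEnd ℂ).toAddMonoidHom.toIntLinearMap

/-- The complexified trivialization `ℋ_x ≃ ℂⁿ` induced by the trivialization at `b`. -/
def trivC (b x : X) : V.H x ≃ₗ[ℂ] (Fin n → ℂ) :=
  ((V.triv b x).baseChange ℤ ℂ _ _).trans (TensorProduct.piScalarRight ℤ ℂ ℂ (Fin n))

end IntegralLocalSystem

/-- A function on an open subset `B` of `ℂ`, extended by zero to `ℂ`. -/
def extendZero {B : Opens ℂ} {W : Type*} [Zero W] (f : B → W) (z : ℂ) : W :=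
  open Classical in if h : z ∈ B then f ⟨z, h⟩ else 0

/-- `f` is a holomorphic function on the open subset `W` of `B`. -/
def IsHolomorphicFun {B : Opens ℂ} (f : B → ℂ) (W : Opens B) : Prop :=
  ∀ b ∈ W, DifferentiableAt ℂ (extendZero f) b

namespace IntegralLocalSystem

variable {B : Opens ℂ} {n : ℕ} (V : IntegralLocalSystem.{u} B n)

/-- The vector-valued function representing a section `s` of `ℋ` in the flat trivialization at
the point `b` (meaningful near `b`). -/
def localExpr (s : ∀ x, V.H x) (b : B) : ℂ → Fin n → ℂ :=
  extendZero fun x => V.trivC b x (s x)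

/-- The section `s` of `ℋ = 𝕍_ℤ ⊗ 𝒪_B` is holomorphic on the open subset `W` of `B`. -/
def IsHolomorphic (s : ∀ x, V.H x) (W : Opens B) : Prop :=
  ∀ b ∈ W, DifferentiableAt ℂ (V.localExpr s b) b

/-- The Gauss-Manin connection on (holomorphic) sections of `ℋ`: in a flat trivialization it is
the exterior derivative `d`. The value at `b` is an element of
`ℋ_b ⊗ Ω¹_{B,b} = Hom(T_{B,b}, ℋ_b)`, where `T_{B,b} = ℂ`. -/
def gaussManin (s : ∀ x, V.H x) (b : B) : ℂ →ₗ[ℂ] V.H b :=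
  (V.trivC b b).symm.toLinearMap ∘ₗ (fderiv ℂ (V.localExpr s b) b).toLinearMap

/-- The derivation `∇_t`, contraction of the Gauss-Manin connection with the coordinate vector
field `∂/∂t`. -/
def gaussManinT (s : ∀ x, V.H x) : ∀ x, V.H x :=
  fun b => V.gaussManin s b 1

end IntegralLocalSystem

/-- A polarized variation of Hodge structures of weight one (of genus `g`) over an open subset `B`
of `ℂ`: a local system of free abelian groups of rank `2g`, a flat unimodular antisymmetric
integral form `Q` on it, and a holomorphic subbundle `E = E^{1,0}` of `ℋ` of rank `g` satisfying
the two Riemann bilinear relations, i.e. `E` is isotropic for `Q_ℂ` (equivalently, `E` and its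
conjugate are orthogonal for the Hodge metric) and the Hodge metric `h(u,v) = i Q_ℂ(u, v̄)` is
positive definite on `E`. -/
structure PVHS (B : Opens ℂ) (g : ℕ) where
  V : IntegralLocalSystem.{u} B (2 * g)
  Q : ∀ x, LinearMap.BilinForm ℤ (V.fiber x)
  Q_flat : ∀ b y : B, y ∈ V.dom b → ∀ v w : Fin (2 * g) → ℤ, ∀ᶠ x in 𝓝 y,
    Q x ((V.triv b x).symm v) ((V.triv b x).symm w) =
      Q y ((V.triv b y).symm v) ((V.triv b y).symm w)
  Q_antisymm : ∀ x u v, Q x u v = -Q x v u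
  Q_unimodular : ∀ x, Function.Bijective (Q x : V.fiber x → Module.Dual ℤ (V.fiber x))
  E : ∀ x, Submodule ℂ (V.H x)
  E_holomorphic_subbundle : ∀ b : B, ∃ W : Opens B, b ∈ W ∧ ∃ e : Fin g → ∀ x, V.H x,
    (∀ i, V.IsHolomorphic (e i) W) ∧
    ∀ x ∈ W, LinearIndependent ℂ (fun i => e i x) ∧
      Submodule.span ℂ (Set.range fun i => e i x) = E x
  E_isotropic : ∀ x, ∀ u ∈ E x, ∀ v ∈ E x, (Q x).baseChange ℂ u v = 0
  hodge_metric_pos : ∀ x, ∀ u ∈ E x, u ≠ 0 →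
    ∃ r : ℝ, 0 < r ∧ Complex.I * (Q x).baseChange ℂ u (V.conj x u) = r

namespace PVHS

variable {B : Opens ℂ} {g : ℕ} (P : PVHS.{u} B g)

/-- `α` restricts to a holomorphic section of `E` on the open subset `W` of `B`. -/
def IsSectionE (α : ∀ x, P.V.H x) (W : Opens B) : Prop :=
  P.V.IsHolomorphic α W ∧ ∀ x ∈ W, α x ∈ P.E x

/-- The Higgs field `θ = π₂ ∘ ∇ ∘ ι₁`, where `π₂ : ℋ → E^{0,1} = ℋ/E` is the projection.
The value at `x` is an element of `E^{0,1}_x ⊗ Ω¹_{B,x} = Hom(T_{B,x}, ℋ_x/E_x)`.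
It is meant to be applied to sections of `E`. -/
def higgs (α : ∀ x, P.V.H x) (x : B) : ℂ →ₗ[ℂ] (P.V.H x ⧸ P.E x) :=
  (P.E x).mkQ ∘ₗ P.V.gaussManin α x

/-- `σ` is a section over `W` of the flat unitary local system `𝕌 = ker (∇ ∘ ι₁)`. -/
def IsSectionFlatUnitary (σ : ∀ x, P.V.H x) (W : Opens B) : Prop :=
  P.IsSectionE σ W ∧ ∀ x ∈ W, P.V.gaussManin σ x = 0

/-- `α` is a global section of the flat unitary subbundle `𝒰 = 𝕌 ⊗ 𝒪_B ⊆ E`: locally on `B` it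
is a combination of sections of `𝕌` with holomorphic coefficients. -/
def IsSectionU (α : ∀ x, P.V.H x) : Prop :=
  ∀ b : B, ∃ W : Opens B, b ∈ W ∧ ∃ (m : ℕ) (f : Fin m → B → ℂ) (σ : Fin m → ∀ x, P.V.H x),
    (∀ i, IsHolomorphicFun (f i) W) ∧ (∀ i, P.IsSectionFlatUnitary (σ i) W) ∧
    ∀ x ∈ W, α x = ∑ i, f i x • σ i x

/-- `α` is a global section of the kernel subsheaf `𝒦 = ker θ ⊆ E`. -/
def IsSectionK (α : ∀ x, P.V.H x) : Prop :=
  P.IsSectionE α ⊤ ∧ ∀ x, P.higgs α x = 0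

end PVHS

/-- The open disk in `ℂ` with centre `c` and radius `r`. -/
def openDisk (c : ℂ) (r : ℝ) : Opens ℂ := ⟨Metric.ball c r, Metric.isOpen_ball⟩

end

/-!
The question is local on the base, so work on a small ball `D` in a flat trivialization: `E` becomes
a holomorphic family of `g`-dimensional subspaces `E z` of a fixed vector space `ℂ^(2g)`, the
Gauss-Manin derivation becomes `d/dz`, and `θ` of a section vanishes at `z` exactly when its
derivative lies in `E z`.

If `α = ∑ fᵢ σᵢ` with `σᵢ` flat sections of `E`, then `∇_t α = ∑ fᵢ' σᵢ` has the same shape, so all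
derivatives of `α` stay in `E` (`PVHS.IsSectionU.gaussManinT`).

Conversely, if `θ (∇_t^j α) = 0` for `j < g`, then the `g + 1` sections `α, …, α^(g)` lie in the
rank `g` bundle `E`, hence are linearly dependent at every point. Let `m` be minimal such that
`α, …, α^(m)` are dependent at every point; then `m ≤ g` and `α, …, α^(m-1)` are independent near
some point `y`. There `α^(m)` is a combination of the lower derivatives with holomorphic
coefficients, so by differentiation the span of `α, …, α^(m-1)` contains every derivative of `α`.
By Taylor expansion and the identity theorem `α` and all its derivatives take values in the constant
space `F` spanned by `α(y), …, α^(m-1)(y)`. By dimension, `F` is the span of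
`α(z), …, α^(m-1)(z)` for `z` near `y`, so `F ≤ E z` there, and again by the identity theorem
`F ≤ E z` on all of `D` (`exists_constant_submodule`). A basis of `F` therefore consists of flat
sections of `E`, and the coordinates of `α` in this basis are holomorphic.
-/

open Filter

/-! ### Holomorphic families of subspaces of a fixed vector space -/

section Analytic

variable {V : Type*} [NormedAddCommGroup V] [NormedSpace ℂ V] [FiniteDimensional ℂ V]

/-- A holomorphic family of vectors that is independent at `b` has holomorphic coordinate functionals
near `b`: for a left inverse `A` of the frame at `b`, correct `A` at `z` by the inverse of its
composition with the frame at `z`. -/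
theorem exists_holomorphic_dual_frame {ι : Type*} [Fintype ι] {e : ι → ℂ → V} {b : ℂ}
    (he : ∀ i, ∀ᶠ z in 𝓝 b, DifferentiableAt ℂ (e i) z)
    (hli : LinearIndependent ℂ fun i => e i b) :
    ∃ Φ : ℂ → V →L[ℂ] (ι → ℂ), ∀ᶠ z in 𝓝 b, DifferentiableAt ℂ Φ z ∧
      ∀ c : ι → ℂ, Φ z (∑ i, c i • e i z) = c := by
  classical
  let L : ℂ → (ι → ℂ) →L[ℂ] V := fun z =>
    ∑ i, (ContinuousLinearMap.proj (R := ℂ) (φ := fun _ : ι => ℂ) i).smulRight (e i z)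
  have hL : ∀ z c, L z c = ∑ i, c i • e i z := fun z c => by simp [L]
  have hLdiff : ∀ᶠ z in 𝓝 b, DifferentiableAt ℂ L z := by
    filter_upwards [eventually_all.2 he] with z hz
    refine DifferentiableAt.fun_sum fun i _ => ?_
    exact ((ContinuousLinearMap.smulRightL ℂ (ι → ℂ) V
      (ContinuousLinearMap.proj (R := ℂ) (φ := fun _ : ι => ℂ) i)).differentiableAt).comp z (hz i)
  have hker : LinearMap.ker (L b).toLinearMap = ⊥ := by
    refine LinearMap.ker_eq_bot'.2 fun c hc => ?_
    have hc' : ∑ i, c i • e i b = 0 := by rw [← hL]; exact hc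
    exact funext fun i => Fintype.linearIndependent_iff.1 hli c hc' i
  obtain ⟨A, hA⟩ := LinearMap.exists_leftInverse_of_injective _ hker
  let A' : V →L[ℂ] (ι → ℂ) := LinearMap.toContinuousLinearMap A
  let M : ℂ → (ι → ℂ) →L[ℂ] (ι → ℂ) := fun z => A'.comp (L z)
  have hMb : M b = 1 := by
    ext1 c
    exact LinearMap.congr_fun hA c
  have hMdiff : ∀ᶠ z in 𝓝 b, DifferentiableAt ℂ M z := by
    filter_upwards [hLdiff] with z hz
    exact (differentiableAt_const A').clm_comp hz
  have hunit : ∀ᶠ z in 𝓝 b, IsUnit (M z) := by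
    refine hMdiff.self_of_nhds.continuousAt.eventually (Units.isOpen.mem_nhds ?_)
    rw [hMb]
    exact isUnit_one
  refine ⟨fun z => (Ring.inverse (M z)).comp A', ?_⟩
  filter_upwards [hMdiff, hunit] with z hz hu
  refine ⟨?_, fun c => ?_⟩
  · obtain ⟨u, hu⟩ := hu
    have : DifferentiableAt ℂ Ring.inverse (M z) := hu ▸ differentiableAt_inverse u.isUnit
    exact (this.comp z hz).clm_comp (differentiableAt_const A')
  · have h := congrArg (fun T : (ι → ℂ) →L[ℂ] (ι → ℂ) => T c) (Ring.inverse_mul_cancel _ hu)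
    rw [← hL]
    exact h

/-- Identity theorem modulo a subspace. -/
theorem mem_submodule_of_eventually_mem {D : Set ℂ} (hD : IsOpen D) (hDc : IsPreconnected D)
    {f : ℂ → V} (hf : DifferentiableOn ℂ f D) (F : Submodule ℂ V) {y : ℂ} (hy : y ∈ D)
    (h : ∀ᶠ z in 𝓝 y, f z ∈ F) {x : ℂ} (hx : x ∈ D) : f x ∈ F := by
  obtain ⟨q, hq⟩ : ∃ q : V →ₗ[ℂ] V, LinearMap.ker q = F := by
    obtain ⟨G, hG⟩ := F.exists_isCompl
    exact ⟨_, Submodule.ker_projection hG.symm⟩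
  have hqf : DifferentiableOn ℂ (fun z => LinearMap.toContinuousLinearMap q (f z)) D :=
    (LinearMap.toContinuousLinearMap q).differentiable.comp_differentiableOn hf
  have h0 := (hqf.analyticOnNhd hD).eqOn_zero_of_preconnected_of_eventuallyEq_zero hDc hy
    (by filter_upwards [h] with z hz; rw [← hq] at hz; exact hz) hx
  rw [← hq]
  exact h0

theorem differentiableOn_iterate_deriv {D : Set ℂ} (hD : IsOpen D) {f : ℂ → V}
    (hf : DifferentiableOn ℂ f D) (n : ℕ) : DifferentiableOn ℂ (deriv^[n] f) D := by
  induction n with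
  | zero => exact hf
  | succ n ih => rw [Function.iterate_succ_apply']; exact ih.deriv hD

/-- Taylor expansion, followed by the identity theorem. -/
theorem mem_submodule_of_iterate_deriv_mem {D : Set ℂ} (hD : IsOpen D) (hDc : IsPreconnected D)
    {f : ℂ → V} (hf : DifferentiableOn ℂ f D) (F : Submodule ℂ V) {y : ℂ} (hy : y ∈ D)
    (h : ∀ n, deriv^[n] f y ∈ F) {x : ℂ} (hx : x ∈ D) : f x ∈ F := by
  obtain ⟨r, hr, hball⟩ := Metric.isOpen_iff.1 hD y hy
  refine mem_submodule_of_eventually_mem hD hDc hf F hy ?_ hx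
  filter_upwards [Metric.ball_mem_nhds y hr] with z hz
  have hs := Complex.hasSum_taylorSeries_on_ball (hf.mono hball) hz
  refine F.closed_of_finiteDimensional.mem_of_tendsto hs (.of_forall fun s => ?_)
  refine F.sum_mem fun n _ => ?_
  rw [iteratedDeriv_eq_iterate]
  exact F.smul_mem _ (F.smul_mem _ (h n))

/-- If a holomorphic function `f` and its first `g` derivatives take values in a holomorphic family
`E` of `g`-dimensional subspaces, then `f` takes values in a constant subspace contained in every member
of the family. The family is given by a frame `e` with holomorphic coordinates `Φ`. -/
theorem exists_constant_submodule {D : Set ℂ} (hD : IsOpen D) (hDc : IsPreconnected D)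
    (hne : D.Nonempty) {g : ℕ} {E : ℂ → Submodule ℂ V}
    {e : Fin g → ℂ → V} (he : ∀ i, DifferentiableOn ℂ (e i) D)
    (hspan : ∀ z ∈ D, Submodule.span ℂ (Set.range fun i => e i z) = E z)
    {Φ : ℂ → V →L[ℂ] (Fin g → ℂ)} (hΦ : DifferentiableOn ℂ Φ D)
    (hΦe : ∀ z ∈ D, ∀ c : Fin g → ℂ, Φ z (∑ i, c i • e i z) = c)
    {f : ℂ → V} (hf : DifferentiableOn ℂ f D) (hfE : ∀ j ≤ g, ∀ z ∈ D, deriv^[j] f z ∈ E z) :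
    ∃ F : Submodule ℂ V, ∀ z ∈ D, f z ∈ F ∧ F ≤ E z := by
  classical
  have hrank : ∀ z ∈ D, Module.finrank ℂ (E z) ≤ g := fun z hz => by
    rw [← hspan z hz]
    exact (finrank_range_le_card (R := ℂ) fun i => e i z).trans_eq (Fintype.card_fin g)
  have hdep : ∀ z ∈ D, ¬ LinearIndependent ℂ fun j : Fin (g + 1) => deriv^[j] f z := by
    intro z hz hli
    have hli' : LinearIndependent ℂ
        fun j : Fin (g + 1) => (⟨_, hfE j (by omega) z hz⟩ : E z) :=
      LinearIndependent.of_comp (E z).subtype hli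
    have hcard := hli'.fintype_card_le_finrank.trans (hrank z hz)
    rw [Fintype.card_fin] at hcard
    omega
  have hex : ∃ k, ∀ z ∈ D, ¬ LinearIndependent ℂ fun j : Fin k => deriv^[j] f z :=
    ⟨g + 1, hdep⟩
  have hspec := Nat.find_spec hex
  have hkg : Nat.find hex ≤ g + 1 := Nat.find_min' hex hdep
  -- The minimal length is positive because the empty family is independent.
  obtain ⟨m, hm⟩ : ∃ m, Nat.find hex = m + 1 := by
    refine Nat.exists_eq_succ_of_ne_zero fun h0 => ?_
    obtain ⟨z, hz⟩ := hne
    rw [h0] at hspec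
    exact hspec z hz linearIndependent_empty_type
  rw [hm] at hspec hkg
  obtain ⟨y, hy, hli⟩ : ∃ y ∈ D, LinearIndependent ℂ fun j : Fin m => deriv^[j] f y := by
    simpa using Nat.find_min hex (m := m) (by omega)
  have ha := fun n => differentiableOn_iterate_deriv hD hf n
  have hDy : ∀ᶠ z in 𝓝 y, z ∈ D := hD.mem_nhds hy
  obtain ⟨Ψ, hΨ⟩ := exists_holomorphic_dual_frame (e := fun j : Fin m => deriv^[j] f) (b := y)
    (fun j => by filter_upwards [hDy] with z hz using (ha j).differentiableAt (hD.mem_nhds hz)) hli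
  have hliN : ∀ᶠ z in 𝓝 y, LinearIndependent ℂ fun j : Fin m => deriv^[j] f z := by
    filter_upwards [hΨ] with z hz
    refine Fintype.linearIndependent_iff.2 fun c hc i => ?_
    have := hz.2 c
    rw [hc, map_zero] at this
    exact (congrFun this i).symm
  have hmem : ∀ n, ∀ᶠ z in 𝓝 y,
      deriv^[n] f z ∈ Submodule.span ℂ (Set.range fun j : Fin m => deriv^[j] f z) := by
    -- At order `m` minimality is used: the derivatives of order at most `m` are dependent everywhere.
    have hlow : ∀ n ≤ m, ∀ᶠ z in 𝓝 y,
        deriv^[n] f z ∈ Submodule.span ℂ (Set.range fun j : Fin m => deriv^[j] f z) := by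
      intro n hn
      rcases hn.lt_or_eq with hn | rfl
      · exact .of_forall fun z => Submodule.subset_span ⟨⟨n, hn⟩, rfl⟩
      · filter_upwards [hDy, hliN] with z hz hzl
        by_contra hnot
        refine hspec z hz ?_
        refine linearIndependent_finSucc'.2 ⟨?_, ?_⟩
        · exact hzl
        · exact hnot
    intro n
    induction n with
    | zero => exact hlow 0 (Nat.zero_le _)
    | succ n ih =>
      -- The coefficients of `f⁽ⁿ⁾` are holomorphic, so its expansion can be differentiated.
      have hcomb : ∀ᶠ z in 𝓝 y,
          deriv^[n] f z = ∑ j : Fin m, Ψ z (deriv^[n] f z) j • deriv^[j] f z := by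
        filter_upwards [ih, hΨ] with z hz hzΨ
        obtain ⟨c, hc⟩ := (Submodule.mem_span_range_iff_exists_fun ℂ).1 hz
        rw [← hc, hzΨ.2 c]
      filter_upwards [hcomb.eventually_nhds, hΨ, hDy,
        eventually_all.2 fun j : Fin m => hlow (j + 1) j.2] with z hz hzΨ hzD hzj
      have hc : DifferentiableAt ℂ (fun z => Ψ z (deriv^[n] f z)) z :=
        hzΨ.1.clm_apply ((ha n).differentiableAt (hD.mem_nhds hzD))
      have hder : HasDerivAt (fun z => ∑ j : Fin m, Ψ z (deriv^[n] f z) j • deriv^[j] f z) _ z :=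
        HasDerivAt.fun_sum fun j _ =>
          (differentiableAt_pi.1 hc j).hasDerivAt.smul
            ((ha j).differentiableAt (hD.mem_nhds hzD)).hasDerivAt
      rw [Function.iterate_succ_apply', Filter.EventuallyEq.deriv_eq hz, hder.deriv]
      refine Submodule.sum_mem _ fun j _ => Submodule.add_mem _ ?_ ?_
      · refine Submodule.smul_mem _ _ ?_
        rw [← Function.iterate_succ_apply' deriv]
        exact hzj j
      · exact Submodule.smul_mem _ _ (Submodule.subset_span ⟨j, rfl⟩)
  -- `F` is the span at the single point `y`; it will also be the span at all nearby points.
  let F := Submodule.span ℂ (Set.range fun j : Fin m => deriv^[j] f y)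
  have hF : ∀ j, ∀ z ∈ D, deriv^[j] f z ∈ F := fun j z hz => by
    refine mem_submodule_of_iterate_deriv_mem hD hDc (ha j) F hy (fun n => ?_) hz
    rw [← Function.iterate_add_apply]
    exact (hmem _).self_of_nhds
  have hFE : ∀ᶠ z in 𝓝 y, F ≤ E z := by
    filter_upwards [hDy, hliN] with z hz hzl
    have : Submodule.span ℂ (Set.range fun j : Fin m => deriv^[j] f z) = F := by
      refine Submodule.eq_of_le_of_finrank_eq ?_ ?_
      · rw [Submodule.span_le]
        rintro _ ⟨j, rfl⟩
        exact hF j z hz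
      · rw [finrank_span_eq_card hzl, finrank_span_eq_card hli]
    rw [← this, Submodule.span_le]
    rintro _ ⟨j, rfl⟩
    exact hfE j (by omega) z hz
  refine ⟨F, fun z hz => ⟨hF 0 z hz, fun v hv => ?_⟩⟩
  have hmemE : ∀ z ∈ D, ∀ c : Fin g → ℂ, ∑ i, c i • e i z ∈ E z := fun z hz c => by
    rw [← hspan z hz]
    exact Submodule.sum_mem _ fun i _ => Submodule.smul_mem _ _ (Submodule.subset_span ⟨i, rfl⟩)
  -- `v` lies in `E x` iff it equals `∑ i, Φ x v i • e i x`, a holomorphic condition on `x`.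
  have hdiff : DifferentiableOn ℂ (fun x => v - ∑ i, Φ x v i • e i x) D := by
    have hΦv : DifferentiableOn ℂ (fun x => Φ x v) D := hΦ.clm_apply (differentiableOn_const v)
    refine (differentiableOn_const v).sub (DifferentiableOn.fun_sum fun i _ => ?_)
    exact (differentiableOn_pi.1 hΦv i).smul (he i)
  have hzero := mem_submodule_of_eventually_mem hD hDc hdiff ⊥ hy (by
    filter_upwards [hFE, hDy] with x hx hxD
    have hvx := hx hv
    rw [← hspan x hxD] at hvx
    obtain ⟨c, hc⟩ := (Submodule.mem_span_range_iff_exists_fun ℂ).1 hvx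
    rw [Submodule.mem_bot, ← hc, hΦe x hxD c, sub_self]) hz
  rw [Submodule.mem_bot, sub_eq_zero] at hzero
  rw [hzero]
  exact hmemE z hz _

end Analytic

/-! ### Functions on an open subset extended by zero -/

section ExtendZero

variable {B : Opens ℂ} {W : Type*} [Zero W]

theorem extendZero_coe (f : B → W) (b : B) : extendZero f b = f b := by
  simp [extendZero]

theorem eventually_nhds_coe_iff {b : B} {p : ℂ → Prop} :
    (∀ᶠ z in 𝓝 (b : ℂ), p z) ↔ ∀ᶠ x : B in 𝓝 b, p x := by
  rw [← B.isOpen.isOpenEmbedding_subtypeVal.map_nhds_eq b, eventually_map]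
  rfl

theorem extendZero_eventuallyEq {f : B → W} {F : ℂ → W} {b : B} (h : ∀ᶠ x in 𝓝 b, f x = F x) :
    extendZero f =ᶠ[𝓝 (b : ℂ)] F := by
  refine eventually_nhds_coe_iff.2 ?_
  filter_upwards [h] with x hx
  rw [extendZero_coe, hx]

end ExtendZero

/-! ### The Gauss-Manin connection in flat trivializations -/

namespace IntegralLocalSystem

variable {B : Opens ℂ} {n : ℕ} (V : IntegralLocalSystem.{u} B n)

/-- Flat trivializations differ locally by a constant linear map, the complexification of a transition
function of the local system. -/
theorem exists_trivC_eq {b y : B} (hy : y ∈ V.dom b) :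
    ∃ T : (Fin n → ℂ) ≃L[ℂ] (Fin n → ℂ),
      ∀ᶠ x in 𝓝 y, ∀ h : V.H x, V.trivC y x h = T (V.trivC b x h) := by
  let e := (V.triv b y).symm.trans (V.triv y y)
  let p := TensorProduct.piScalarRight ℤ ℂ ℂ (Fin n)
  refine ⟨((p.symm.trans (e.baseChange ℤ ℂ _ _)).trans p).toContinuousLinearEquiv, ?_⟩
  filter_upwards [V.transition_locally_constant b y y hy (V.mem_dom y)] with x hx h
  have htriv : V.triv y x = (V.triv b x).trans e := by
    change _ = (V.triv b x).trans ((V.triv b y).symm.trans (V.triv y y))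
    rw [← hx]
    ext1 v
    simp
  suffices hs : (V.triv y x).baseChange ℤ ℂ _ _ h =
      e.baseChange ℤ ℂ _ _ ((V.triv b x).baseChange ℤ ℂ _ _ h) by
    simp only [trivC, LinearEquiv.trans_apply, LinearEquiv.coe_toContinuousLinearEquiv', p, hs,
      LinearEquiv.symm_apply_apply]
  rw [htriv]
  induction h using TensorProduct.induction_on with
  | zero => simp only [map_zero]
  | tmul c v => simp
  | add h₁ h₂ ih₁ ih₂ => simp only [map_add, ih₁, ih₂]

theorem localExpr_coe (s : ∀ x, V.H x) (b x : B) : V.localExpr s b x = V.trivC b x (s x) :=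
  extendZero_coe _ x

theorem exists_localExpr_eventuallyEq {b y : B} (hy : y ∈ V.dom b) :
    ∃ T : (Fin n → ℂ) ≃L[ℂ] (Fin n → ℂ), (∀ h : V.H y, V.trivC y y h = T (V.trivC b y h)) ∧
      ∀ s : ∀ x, V.H x, V.localExpr s y =ᶠ[𝓝 (y : ℂ)] T ∘ V.localExpr s b := by
  obtain ⟨T, hT⟩ := V.exists_trivC_eq hy
  refine ⟨T, hT.self_of_nhds, fun s => extendZero_eventuallyEq ?_⟩
  filter_upwards [hT] with x hx
  rw [hx, Function.comp_apply, localExpr_coe]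

theorem differentiableAt_localExpr_iff (s : ∀ x, V.H x) {b y : B} (hy : y ∈ V.dom b) :
    DifferentiableAt ℂ (V.localExpr s y) y ↔ DifferentiableAt ℂ (V.localExpr s b) y := by
  obtain ⟨T, -, hT⟩ := V.exists_localExpr_eventuallyEq hy
  rw [(hT s).differentiableAt_iff, T.comp_differentiableAt_iff]

/-- `∇_t` is computed by `d/dt` in any flat trivialization around the point. No differentiability is
needed, since composition with a linear isomorphism commutes with `fderiv` on all functions. -/
theorem trivC_gaussManinT (s : ∀ x, V.H x) {b y : B} (hy : y ∈ V.dom b) :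
    V.trivC b y (V.gaussManinT s y) = deriv (V.localExpr s b) y := by
  obtain ⟨T, hTy, hT⟩ := V.exists_localExpr_eventuallyEq hy
  apply T.injective
  rw [← hTy, gaussManinT, gaussManin, (hT s).fderiv_eq, T.comp_fderiv]
  simp

theorem localExpr_gaussManinT_eventuallyEq (s : ∀ x, V.H x) {b y : B} (hy : y ∈ V.dom b) :
    V.localExpr (V.gaussManinT s) b =ᶠ[𝓝 (y : ℂ)] deriv (V.localExpr s b) := by
  refine extendZero_eventuallyEq ?_
  filter_upwards [(V.dom b).isOpen.mem_nhds hy] with x hx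
  exact V.trivC_gaussManinT s hx

theorem localExpr_iterate_gaussManinT (s : ∀ x, V.H x) {b : B} (j : ℕ) {y : B}
    (hy : y ∈ V.dom b) :
    V.localExpr (V.gaussManinT^[j] s) b =ᶠ[𝓝 (y : ℂ)] deriv^[j] (V.localExpr s b) := by
  induction j with
  | zero => rfl
  | succ j ih =>
    rw [Function.iterate_succ_apply', Function.iterate_succ_apply']
    exact (V.localExpr_gaussManinT_eventuallyEq _ hy).trans ih.deriv

theorem gaussManin_eq_zero_iff (s : ∀ x, V.H x) (x : B) :
    V.gaussManin s x = 0 ↔ V.gaussManinT s x = 0 :=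
  ⟨fun h => by rw [gaussManinT, h, LinearMap.zero_apply], fun h => LinearMap.ext_ring h⟩

theorem IsHolomorphic.gaussManinT {V : IntegralLocalSystem.{u} B n} {s : ∀ x, V.H x}
    {W : Opens B} (h : V.IsHolomorphic s W) : V.IsHolomorphic (V.gaussManinT s) W := by
  intro b hb
  rw [(V.localExpr_gaussManinT_eventuallyEq s (V.mem_dom b)).differentiableAt_iff]
  have hd : ∀ᶠ z in 𝓝 (b : ℂ), DifferentiableAt ℂ (V.localExpr s b) z := by
    refine eventually_nhds_coe_iff.2 ?_
    filter_upwards [W.isOpen.mem_nhds hb, (V.dom b).isOpen.mem_nhds (V.mem_dom b)] with x hx hxb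
    exact (V.differentiableAt_localExpr_iff s hxb).1 (h x hx)
  exact (Complex.analyticAt_iff_eventually_differentiableAt.2 hd).deriv.differentiableAt

end IntegralLocalSystem

theorem IsHolomorphicFun.deriv {B : Opens ℂ} {f : B → ℂ} {W : Opens B}
    (h : IsHolomorphicFun f W) :
    IsHolomorphicFun (fun x : B => _root_.deriv (extendZero f) x) W := by
  intro b hb
  have hd : ∀ᶠ z in 𝓝 (b : ℂ), DifferentiableAt ℂ (extendZero f) z := by
    refine eventually_nhds_coe_iff.2 ?_
    filter_upwards [W.isOpen.mem_nhds hb] with x hx using h x hx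
  rw [(extendZero_eventuallyEq (F := _root_.deriv (extendZero f))
    (.of_forall fun _ => rfl)).differentiableAt_iff]
  exact (Complex.analyticAt_iff_eventually_differentiableAt.2 hd).deriv.differentiableAt

/-! ### Sections of the flat unitary subbundle -/

namespace PVHS

variable {B : Opens ℂ} {g : ℕ} (P : PVHS.{u} B g)

theorem higgs_eq_zero_iff (s : ∀ x, P.V.H x) (x : B) :
    P.higgs s x = 0 ↔ P.V.gaussManinT s x ∈ P.E x := by
  rw [← Submodule.Quotient.mk_eq_zero]
  exact ⟨fun h => LinearMap.congr_fun h 1, fun h => LinearMap.ext_ring h⟩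

variable {P}

theorem IsSectionU.mem_E {s : ∀ x, P.V.H x} (h : P.IsSectionU s) (x : B) : s x ∈ P.E x := by
  obtain ⟨W, hx, m, f, σ, -, hσ, hs⟩ := h x
  rw [hs x hx]
  exact Submodule.sum_mem _ fun i _ => Submodule.smul_mem _ _ ((hσ i).1.2 x hx)

theorem IsSectionU.gaussManinT {s : ∀ x, P.V.H x} (h : P.IsSectionU s) :
    P.IsSectionU (P.V.gaussManinT s) := by
  intro b
  obtain ⟨W, hb, m, f, σ, hf, hσ, hs⟩ := h b
  refine ⟨W, hb, m, fun i x => deriv (extendZero (f i)) x, σ, fun i => (hf i).deriv, hσ,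
    fun x hx => ?_⟩
  apply (P.V.trivC x x).injective
  have hlocal : P.V.localExpr s x =ᶠ[𝓝 (x : ℂ)]
      fun z => ∑ i, extendZero (f i) z • P.V.localExpr (σ i) x z := by
    refine extendZero_eventuallyEq ?_
    filter_upwards [W.isOpen.mem_nhds hx] with y hy
    simp only [hs y hy, map_sum, map_smul, extendZero_coe, P.V.localExpr_coe]
  have hσ' : ∀ i, HasDerivAt (P.V.localExpr (σ i) x) 0 x := by
    intro i
    have h0 := ((P.V.gaussManin_eq_zero_iff _ _).1 ((hσ i).2 x hx))
    have h1 := P.V.trivC_gaussManinT (σ i) (P.V.mem_dom x)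
    rw [h0, map_zero] at h1
    rw [h1]
    exact ((hσ i).1.1 x hx).hasDerivAt
  have hder : HasDerivAt (fun z => ∑ i, extendZero (f i) z • P.V.localExpr (σ i) x z) _ (x : ℂ) :=
    HasDerivAt.fun_sum fun i _ => ((hf i) x hx).hasDerivAt.smul (hσ' i)
  rw [P.V.trivC_gaussManinT s (P.V.mem_dom x), hlocal.deriv_eq, hder.deriv]
  simp only [smul_zero, zero_add, map_sum, map_smul, P.V.localExpr_coe]

theorem IsSectionU.higgs_iterate_eq_zero {s : ∀ x, P.V.H x} (h : P.IsSectionU s) (j : ℕ) (x : B) :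
    P.higgs (P.V.gaussManinT^[j] s) x = 0 := by
  have hU : ∀ k, P.IsSectionU (P.V.gaussManinT^[k] s) := fun k => by
    induction k with
    | zero => exact h
    | succ k ih => rw [Function.iterate_succ_apply']; exact ih.gaussManinT
  rw [P.higgs_eq_zero_iff, ← Function.iterate_succ_apply' P.V.gaussManinT]
  exact (hU (j + 1)).mem_E x

theorem IsSectionE.iterate_gaussManinT {s : ∀ x, P.V.H x} (hs : P.IsSectionE s ⊤) {k : ℕ}
    (h : ∀ j < k, ∀ x, P.higgs (P.V.gaussManinT^[j] s) x = 0) {j : ℕ} (hj : j ≤ k) :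
    P.IsSectionE (P.V.gaussManinT^[j] s) ⊤ := by
  induction j with
  | zero => exact hs
  | succ j ih =>
    rw [Function.iterate_succ_apply']
    exact ⟨(ih (by omega)).1.gaussManinT, fun x _ => (P.higgs_eq_zero_iff _ _).1 (h j (by omega) x)⟩

/-- The converse direction: near each point, the constant subspace of `exists_constant_submodule` is
spanned by flat sections of `E`, in which `α` has holomorphic coordinates. -/
theorem isSectionU_of_higgs_iterate_eq_zero {α : ∀ x, P.V.H x} (hα : P.IsSectionE α ⊤)
    (h : ∀ j < g, ∀ x, P.higgs (P.V.gaussManinT^[j] α) x = 0) : P.IsSectionU α := by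
  intro b
  obtain ⟨W₀, hb₀, e, he, hE⟩ := P.E_holomorphic_subbundle b
  let e' : Fin g → ℂ → (Fin (2 * g) → ℂ) := fun i => P.V.localExpr (e i) b
  have he' : ∀ x ∈ W₀, x ∈ P.V.dom b → ∀ i, DifferentiableAt ℂ (e' i) (x : ℂ) :=
    fun x hx hxb i => (P.V.differentiableAt_localExpr_iff _ hxb).1 (he i x hx)
  have hnhds : ∀ᶠ x in 𝓝 b, x ∈ W₀ ∧ x ∈ P.V.dom b :=
    (W₀ ⊓ P.V.dom b).isOpen.mem_nhds ⟨hb₀, P.V.mem_dom b⟩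
  obtain ⟨Φ, hΦ⟩ := exists_holomorphic_dual_frame (e := e') (b := b)
    (fun i => eventually_nhds_coe_iff.2 (by filter_upwards [hnhds] with x hx using he' x hx.1 hx.2 i))
    (by
      have := (hE b hb₀).1.map' (P.V.trivC b b).toLinearMap (LinearEquiv.ker _)
      simp only [e', P.V.localExpr_coe]
      exact this)
  -- The ball lies in `B`, in the domain of the flat trivialization at `b` and in that of the frame.
  obtain ⟨ρ, hρ, hball⟩ := Metric.eventually_nhds_iff_ball.1
    (hΦ.and ((eventually_nhds_coe_iff (p := fun z => ∃ hz : z ∈ B, (⟨z, hz⟩ : B) ∈ W₀ ∧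
      (⟨z, hz⟩ : B) ∈ P.V.dom b)).2 (hnhds.mono fun x hx => ⟨x.2, hx⟩)))
  let D := Metric.ball (b : ℂ) ρ
  let a := P.V.localExpr α b
  let E' : ℂ → Submodule ℂ (Fin (2 * g) → ℂ) := fun z =>
    Submodule.span ℂ (Set.range fun i => e' i z)
  have hE' : ∀ x : B, (x : ℂ) ∈ D → E' x = (P.E x).map (P.V.trivC b x).toLinearMap := by
    intro x hx
    obtain ⟨-, _, hxW, hxb⟩ := hball x hx
    rw [← (hE x hxW).2, Submodule.map_span, ← Set.range_comp]
    simp only [E', e', P.V.localExpr_coe]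
    rfl
  obtain ⟨F, hF⟩ := exists_constant_submodule (D := D) Metric.isOpen_ball
    (convex_ball _ _).isPreconnected ⟨b, Metric.mem_ball_self hρ⟩ (E := E') (e := e') (Φ := Φ)
    (f := a)
    (fun i z hz => by
      obtain ⟨-, hzB, hzW, hzb⟩ := hball z hz
      exact (he' ⟨z, hzB⟩ hzW hzb i).differentiableWithinAt)
    (fun z _ => rfl)
    (fun z hz => (hball z hz).1.1.differentiableWithinAt)
    (fun z hz => (hball z hz).1.2)
    (fun z hz => by
      obtain ⟨-, hzB, -, hzb⟩ := hball z hz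
      exact ((P.V.differentiableAt_localExpr_iff α hzb).1
        (hα.1 ⟨z, hzB⟩ trivial)).differentiableWithinAt)
    (fun j hj z hz => by
      obtain ⟨-, hzB, -, hzb⟩ := hball z hz
      have heq := (P.V.localExpr_iterate_gaussManinT α j hzb).self_of_nhds
      rw [P.V.localExpr_coe] at heq
      rw [← heq, hE' ⟨z, hzB⟩ hz]
      exact Submodule.mem_map_of_mem ((hα.iterate_gaussManinT h hj).2 _ trivial))
  let v := Module.finBasis ℂ F
  -- A projection onto `F` extends the coordinates on `F` to linear functionals on `ℂ^(2g)`.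
  obtain ⟨π, hπ⟩ := F.subtype.exists_leftInverse_of_injective F.ker_subtype
  have hπdiff : ∀ i, Differentiable ℂ fun w => v.repr (π w) i := fun i =>
    (LinearMap.toContinuousLinearMap ((v.coord i).comp π)).differentiable
  have hσ : ∀ (i) (y : B),
      P.V.localExpr (fun x => (P.V.trivC b x).symm (v i : Fin (2 * g) → ℂ)) b =ᶠ[𝓝 (y : ℂ)]
        fun _ => (v i : Fin (2 * g) → ℂ) := fun i y =>
    extendZero_eventuallyEq (.of_forall fun x => LinearEquiv.apply_symm_apply _ _)
  let W : Opens B := ⟨Subtype.val ⁻¹' D, Metric.isOpen_ball.preimage continuous_subtype_val⟩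
  have hWdom : ∀ x ∈ W, x ∈ P.V.dom b := fun x hx => (hball x hx).2.2.2
  refine ⟨W, Metric.mem_ball_self hρ, _, fun i x => v.repr (π (a x)) i,
    fun i x => (P.V.trivC b x).symm (v i), fun i x hx => ?_,
    fun i => ⟨⟨fun x hx => ?_, fun x hx => ?_⟩, fun x hx => ?_⟩, fun x hx => ?_⟩
  · rw [(extendZero_eventuallyEq (F := fun z => v.repr (π (a z)) i)
      (.of_forall fun _ => rfl)).differentiableAt_iff]
    exact (hπdiff i).differentiableAt.comp (x : ℂ)
      ((P.V.differentiableAt_localExpr_iff α (hWdom x hx)).1 (hα.1 x trivial))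
  · rw [P.V.differentiableAt_localExpr_iff _ (hWdom x hx), (hσ i x).differentiableAt_iff]
    exact differentiableAt_const _
  · have hv : (v i : Fin (2 * g) → ℂ) ∈ (P.E x).map (P.V.trivC b x).toLinearMap := by
      rw [← hE' x hx]
      exact (hF x hx).2 (v i).2
    obtain ⟨u, hu, huv⟩ := hv
    change (P.V.trivC b x).symm (v i) ∈ P.E x
    rw [← huv]
    simpa using hu
  · rw [P.V.gaussManin_eq_zero_iff]
    apply (P.V.trivC b x).injective
    rw [P.V.trivC_gaussManinT _ (hWdom x hx), (hσ i x).deriv_eq, deriv_const, map_zero]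
  · apply (P.V.trivC b x).injective
    simp only [map_sum, map_smul, LinearEquiv.apply_symm_apply]
    have hax : a x = P.V.trivC b x (α x) := P.V.localExpr_coe α b x
    have hπa : π (a x) = ⟨a x, (hF x hx).1⟩ := LinearMap.congr_fun hπ ⟨a x, (hF x hx).1⟩
    have hsum := congrArg Subtype.val (v.sum_repr (π (a x)))
    rw [← hax]
    calc a x = (π (a x) : F) := by rw [hπa]
      _ = _ := hsum.symm
      _ = _ := by simp only [Submodule.coe_sum, Submodule.coe_smul]

end PVHS

theorem theorem2p3 (c : ℂ) (r : ℝ) (hr : 0 < r) (g : ℕ) (P : PVHS.{u} (openDisk c r) g)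
    (α : ∀ x, P.V.H x) (hα : P.IsSectionE α ⊤) :
    (P.IsSectionU α ↔ ∀ j < g, P.IsSectionK (P.V.gaussManinT^[j] α)) ∧
      (P.IsSectionU α ↔ ∀ j < g, ∀ x, P.higgs (P.V.gaussManinT^[j] α) x = 0) := by
  have h₂ : P.IsSectionU α ↔ ∀ j < g, ∀ x, P.higgs (P.V.gaussManinT^[j] α) x = 0 :=
    ⟨fun h j _ => h.higgs_iterate_eq_zero j, PVHS.isSectionU_of_higgs_iterate_eq_zero hα⟩
  refine ⟨h₂.trans ⟨fun h j hj => ⟨hα.iterate_gaussManinT h hj.le, h j hj⟩,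
    fun h j hj => (h j hj).2⟩, h₂⟩
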